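/- Let $\mathcal N_n(\rho)=\sum_{u,v\in\mathbb Z_2^n}p_{u,v}\,X^uZ^v\rho Z^vX^u$ be an $n$-qubit Pauli channel ($p_{u,v}\ge 0$, $\sum_{u,v}p_{u,v}=1$), where $X^u|x\rangle=|x+u\rangle$ and $Z^v|x\rangle=(-1)^{x\cdot v}|x\rangle$. Let $C\subseteq\mathbb Z_2^n$ be an $[n,k]$ linear code with generator matrix $G$ ($n\times k$, column space $C$), parity check matrix $H$ ($(n-k)\times n$, null space $C$) and an inverse syndrome function $\hat u:\mathbb Z_2^{n-k}\to\mathbb Z_2^n$, $H\hat u(e)=e$. Put $p_u=\sum_v p_{u,v}$, $p_e=\sum_{u:Hu=e}p_u$, $p_{u|e}=I(Hu=e)\,p_u/p_e$, and let $\epsilon=\sum_e p_e\,(1-p_{\hat u(e)|e})$ be the average bit-flip decoding error (syndromes with $p_e=0$ contribute $0$). Let $f:\mathbb Z_2^k\to\mathbb Z_2^m$ be a random function that is two-universal, i.e. $\Pr[f(y)=f(y')]\le 2^{-m}$ for all $y\ne y'$, and each realization of which is affine, $f(y)=Ay+s_0$ with an $m\times k$ matrix $A$ of rank $m$. An $[[n,m]]$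 entanglement generation code consists of an encoding isometry $U:(\mathbb C^2)^{\otimes m}\to(\mathbb C^2)^{\otimes n}$ and a decoding operation $\mathcal D$ (a completely positive trace-preserving map from $n$-qubit to $m$-qubit operators). Its error on $\mathcal N_n$ is $$\big\|(\mathrm{id}_R\otimes \mathcal D\circ\mathcal N_n\circ U)(\Phi^{\otimes m})-\Phi^{\otimes m}\big\|_1,$$ where $\|M\|_1=\operatorname{tr}\sqrt{M^\dagger M}$, $U$ acts on operators by $\rho\mapsto U\rho U^\dagger$, and $\Phi^{\otimes m}$ is the projector onto $2^{-m/2}\sum_{s\in\mathbb Z_2^m}|s\rangle^R|s\rangle$. For a realization of $f$, the code is a P-CSS code (for $G,H,f$) if $U|s\rangle=|\varphi_s(f)\rangle$ for all $s\in\mathbb Z_2^m$, where $$|\varphi_s(f)\rangle=\frac1{\sqrt{2^{k-m}}}\sum_{x\in C_s(f)}|x\rangle,\qquad C_s(f)=\{Gy:\ f(y)=s\},$$ and if the range of $U$ is the CSS code with stabilizers $Z^h$ ($h$ a row of $H$) and $X^c$ ($c\in C'=\{Gy: Ay=0\}$), i.e. their simultaneous $+1$ eigenspace. Then for each realization of $f$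 there is an $[[n,m]]$ entanglement generation code that is a P-CSS code for $G,H,f$, such that this random code is $\eta$-good on average: the expectation over $f$ of its error on $\mathcal N_n$ is at most $$\eta=2\sqrt{2\epsilon'+4\sqrt{2\epsilon}}+2\sqrt{2\epsilon},\qquad \epsilon'=2^{-\frac12\left(H_2(XE)_\omega-H_0(E)_\omega+k-n-m\right)} .$$ Here $$\omega^{XBE}=\frac1{2^n}\sum_{x\in\mathbb Z_2^n}|x\rangle\langle x|^X\otimes|\phi_x\rangle\langle\phi_x|^{BE},\qquad |\phi_x\rangle^{BE}=\sum_{u,v}\sqrt{p_{u,v}}\,(-1)^{x\cdot v}|x+u\rangle^B|u,v\rangle^E ,$$ $H_2(\rho)=-\log_2\operatorname{tr}(\rho^2)$ and $H_0(\rho)=\log_2\operatorname{rank}(\rho)$, evaluated on the reduced states $\omega^{XE}$ and $\omega^{E}$. -/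

import Mathlib

noncomputable section

namespace PCSS

open scoped Matrix

/-- The set `ℤ₂ⁿ` of bit strings; it also indexes the computational basis of `n` qubits. -/
abbrev Bits (n : ℕ) : Type := Fin n → ZMod 2

/-! ### Operators, partial traces, trace norm, quantum operations -/

/-- The rank one operator `|ψ⟩⟨ψ|`. -/
def ketbra {a : Type*} (ψ : a → ℂ) : Matrix a a ℂ := Matrix.vecMulVec ψ (star ψ)

/-- Partial trace over the first tensor factor. -/
def traceFst {a b : Type*} [Fintype a] (ρ : Matrix (a × b) (a × b) ℂ) : Matrix b b ℂ :=
  Matrix.of fun i j => ∑ x, ρ (x, i) (x, j)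

/-- Partial trace over the middle factor of a tripartite system. -/
def traceMid {a b c : Type*} [Fintype b] (ρ : Matrix (a × b × c) (a × b × c) ℂ) :
    Matrix (a × c) (a × c) ℂ :=
  Matrix.of fun i j => ∑ y, ρ (i.1, y, i.2) (j.1, y, j.2)

section
open scoped MatrixOrder ComplexOrder Matrix.Norms.L2Operator

/-- The trace norm `‖M‖₁ = tr |M|`, where `|M| = √(Mᴴ M)`. -/
def traceNorm {a : Type*} [Fintype a] [DecidableEq a] (M : Matrix a a ℂ) : ℝ :=
  (CFC.abs M).trace.re

end

/-- The linear map `ρ ↦ A ρ B`. -/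
def sandwich {a b : Type*} [Fintype a] (A : Matrix b a ℂ) (B : Matrix a b ℂ) :
    Matrix a a ℂ →ₗ[ℂ] Matrix b b ℂ where
  toFun ρ := A * ρ * B
  map_add' ρ σ := by rw [Matrix.mul_add, Matrix.add_mul]
  map_smul' c ρ := by simp

/-- `id_R ⊗ T`: the map `T` applied to the second factor of a bipartite operator. -/
def idTensor {r a b : Type*} (T : Matrix a a ℂ →ₗ[ℂ] Matrix b b ℂ)
    (ρ : Matrix (r × a) (r × a) ℂ) : Matrix (r × b) (r × b) ℂ :=
  Matrix.of fun i j => T (Matrix.of fun x y => ρ (i.1, x) (j.1, y)) i.2 j.2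

section
open scoped ComplexOrder

/-- A quantum operation: a completely positive, trace preserving linear map. -/
structure IsQuantumOperation {a b : Type*} [Fintype a] [Fintype b]
    (T : Matrix a a ℂ →ₗ[ℂ] Matrix b b ℂ) : Prop where
  completelyPositive : ∀ (d : ℕ) (ρ : Matrix (Fin d × a) (Fin d × a) ℂ),
    ρ.PosSemidef → (idTensor T ρ).PosSemidef
  tracePreserving : ∀ ρ : Matrix a a ℂ, (T ρ).trace = ρ.trace

end

/-- Rényi entropy of order `2`. -/
def renyiTwo {a : Type*} [Fintype a] [DecidableEq a] (ρ : Matrix a a ℂ) : ℝ :=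
  1 / (1 - 2) * Real.logb 2 (ρ ^ 2).trace.re

/-- Rényi entropy of order `0`. -/
def renyiZero {a : Type*} [Fintype a] (ρ : Matrix a a ℂ) : ℝ :=
  Real.logb 2 ρ.rank

/-! ### Pauli channels -/

/-- The sign `(-1) ^ (x · v)`. -/
def sign {n : ℕ} (x v : Bits n) : ℂ := (-1) ^ (x ⬝ᵥ v).val

/-- The operator `X^u = X^{u₁} ⊗ ⋯ ⊗ X^{uₙ}`, i.e. `|x⟩ ↦ |x + u⟩`. -/
def pauliX {n : ℕ} (u : Bits n) : Matrix (Bits n) (Bits n) ℂ :=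
  Matrix.of fun y x => if y = x + u then 1 else 0

/-- The operator `Z^v = Z^{v₁} ⊗ ⋯ ⊗ Z^{vₙ}`, i.e. `|x⟩ ↦ (-1)^{x·v} |x⟩`. -/
def pauliZ {n : ℕ} (v : Bits n) : Matrix (Bits n) (Bits n) ℂ :=
  Matrix.diagonal fun x => sign x v

/-- An `n`-qubit Pauli channel, given by the probabilities of the errors `X^u Z^v`. -/
structure PauliChannel (n : ℕ) where
  p : Bits n → Bits n → ℝ
  nonneg : ∀ u v, 0 ≤ p u v
  sum_eq_one : ∑ u, ∑ v, p u v = 1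

namespace PauliChannel

variable {n : ℕ} (N : PauliChannel n)

/-- The action `ρ ↦ ∑ p_{u,v} X^u Z^v ρ Z^v X^u`. -/
def toLinearMap : Matrix (Bits n) (Bits n) ℂ →ₗ[ℂ] Matrix (Bits n) (Bits n) ℂ :=
  ∑ u, ∑ v, (N.p u v : ℂ) • sandwich (pauliX u * pauliZ v) (pauliZ v * pauliX u)

/-- The state `|φ_x⟩^{BE} = ∑ √p_{u,v} (-1)^{x·v} |x+u⟩^B |u,v⟩^E`, the image of `|x⟩` under the
isometric extension of the channel. -/
def phi (x : Bits n) : Bits n × (Bits n × Bits n) → ℂ :=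
  fun i => if i.1 = x + i.2.1 then (Real.sqrt (N.p i.2.1 i.2.2) : ℂ) * sign x i.2.2 else 0

/-- `ω^{XBE} = 2⁻ⁿ ∑ₓ |x⟩⟨x|^X ⊗ |φ_x⟩⟨φ_x|^{BE}`. -/
def omega : Matrix (Bits n × Bits n × (Bits n × Bits n)) (Bits n × Bits n × (Bits n × Bits n)) ℂ :=
  (1 / 2 ^ n : ℂ) • ∑ x, Matrix.kronecker (Matrix.single x x (1 : ℂ)) (ketbra (N.phi x))

def omegaXE : Matrix (Bits n × (Bits n × Bits n)) (Bits n × (Bits n × Bits n)) ℂ :=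
  traceMid N.omega

def omegaE : Matrix (Bits n × Bits n) (Bits n × Bits n) ℂ :=
  traceFst N.omegaXE

/-- The probability `p_u` of the bit flip error `u`. -/
def bitFlip (u : Bits n) : ℝ := ∑ v, N.p u v

end PauliChannel

/-! ### Classical codes -/

/-- An `[n, k]` linear code with its generator matrix `G`, parity check matrix `H` and the inverse
syndrome function `uHat` by which it is decoded. -/
structure ClassicalCode (n k : ℕ) where
  C : Submodule (ZMod 2) (Bits n)
  finrank_eq : Module.finrank (ZMod 2) C = k
  G : Matrix (Fin n) (Fin k) (ZMod 2)
  range_G : LinearMap.range G.mulVecLin = C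
  H : Matrix (Fin (n - k)) (Fin n) (ZMod 2)
  ker_H : LinearMap.ker H.mulVecLin = C
  uHat : Bits (n - k) → Bits n
  syndrome_uHat : ∀ e, H *ᵥ uHat e = e

namespace ClassicalCode

variable {n k : ℕ} (K : ClassicalCode n k) (N : PauliChannel n)

/-- `p_e`, the probability of the syndrome `e`. -/
def syndromeProb (e : Bits (n - k)) : ℝ := ∑ u with K.H *ᵥ u = e, N.bitFlip u

/-- `p_{u|e}`, the probability of the bit flip error `u` given the syndrome `e`. -/
def condProb (u : Bits n) (e : Bits (n - k)) : ℝ :=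
  (if K.H *ᵥ u = e then 1 else 0) * N.bitFlip u / K.syndromeProb N e

/-- The average error probability `ε = ∑ₑ p_e (1 - p_{û(e)|e})`. (Syndromes of probability zero
contribute nothing.) -/
def avgError : ℝ := ∑ e, K.syndromeProb N e * (1 - K.condProb N (K.uHat e) e)

/-- `C_s(f) = {G y : f(y) = s}`. -/
def cosetSet {m : ℕ} (f : Bits k → Bits m) (s : Bits m) : Set (Bits n) :=
  {x | ∃ y, x = K.G *ᵥ y ∧ f y = s}

open Classical in
/-- The quantum codeword `|φ_s(f)⟩ = 2^{-(k-m)/2} ∑_{x ∈ C_s(f)} |x⟩`. -/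
def codeword {m : ℕ} (f : Bits k → Bits m) (s : Bits m) : Bits n → ℂ :=
  fun x => if x ∈ K.cosetSet f s then ((1 / Real.sqrt (2 ^ ((k : ℤ) - (m : ℤ))) : ℝ) : ℂ) else 0

end ClassicalCode

/-! ### Random affine hash functions -/

/-- `f(y) = A y + s₀` with an `m × k` matrix `A` of full rank `m`. -/
def IsFullRankAffine {k m : ℕ} (f : Bits k → Bits m) : Prop :=
  ∃ (A : Matrix (Fin m) (Fin k) (ZMod 2)) (s₀ : Bits m),
    A.rank = m ∧ ∀ y, f y = A *ᵥ y + s₀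

/-- A random function (given by its law) is two-universal if `Pr[f(y) = f(y')] ≤ 2⁻ᵐ` for all
distinct `y, y'`. -/
def IsTwoUniversal {k m : ℕ} (P : PMF (Bits k → Bits m)) : Prop :=
  ∀ y y' : Bits k, y ≠ y' → ∑ f with f y = f y', (P f).toReal ≤ 1 / (Fintype.card (Bits m) : ℝ)

/-! ### Entanglement generation codes -/

/-- The vector `|Φ⟩^{⊗m} = 2^{-m/2} ∑_s |s⟩|s⟩`. -/
def ebits (m : ℕ) : Bits m × Bits m → ℂ :=
  fun i => if i.1 = i.2 then ((1 / Real.sqrt (2 ^ m) : ℝ) : ℂ) else 0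

/-- An `[[n, m]]` entanglement generation code: an encoding isometry and a decoding operation. -/
structure EntGenCode (n m : ℕ) where
  encoder : Matrix (Bits n) (Bits m) ℂ
  isometry : encoderᴴ * encoder = 1
  decoder : Matrix (Bits n) (Bits n) ℂ →ₗ[ℂ] Matrix (Bits m) (Bits m) ℂ
  isQuantumOperation : IsQuantumOperation decoder

/-- `‖(𝒟 ∘ 𝒩 ∘ U)(Φ^{⊗m}) - Φ^{⊗m}‖₁`, the operations acting on the second half of the ebits.
The code is `η`-good if this is at most `η`. -/
def EntGenCode.error {n m : ℕ} (Q : EntGenCode n m) (N : PauliChannel n) : ℝ :=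
  traceNorm
    (idTensor (Q.decoder ∘ₗ N.toLinearMap ∘ₗ sandwich Q.encoder Q.encoderᴴ) (ketbra (ebits m))
      - ketbra (ebits m))

/-- `Q` is a P-CSS code built from the classical code `K` and the affine function `f`: the encoder
takes the basis vector `|s⟩` to the codeword `|φ_s(f)⟩`, and the code space is the CSS code with
stabilizers `Z^h`, `h` a row of `H`, and `X^c`, `c ∈ C' = {G y : f(y) = f(0)}`. -/
structure EntGenCode.IsPCSS {n k m : ℕ} (Q : EntGenCode n m) (K : ClassicalCode n k)
    (f : Bits k → Bits m) : Prop where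
  encoder_eq : ∀ s x, Q.encoder x s = K.codeword f s x
  stabilized : ∀ ψ : Bits n → ℂ, ψ ∈ LinearMap.range Q.encoder.mulVecLin ↔
    (∀ i, pauliZ (K.H i) *ᵥ ψ = ψ) ∧ ∀ c ∈ K.cosetSet f (f 0), pauliX c *ᵥ ψ = ψ

/-- A random code, one code for each realization of `f`, is `η`-good on average. -/
def IsGoodOnAverage {n k m : ℕ} (P : PMF (Bits k → Bits m))
    (Q : (Bits k → Bits m) → EntGenCode n m) (N : PauliChannel n) (η : ℝ) : Prop :=
  ∑ f, (P f).toReal * (Q f).error N ≤ η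

/-- `ε' = 2^{-(H₂(XE)_ω - H₀(E)_ω + k - n - m)/2}`. -/
def privacyError {n : ℕ} (N : PauliChannel n) (k m : ℕ) : ℝ :=
  (2 : ℝ) ^ (-(1 / 2 : ℝ) *
    (renyiTwo N.omegaXE - renyiZero N.omegaE + (k : ℝ) - (n : ℝ) - (m : ℝ)))

end PCSS

end

/-!
The decoder measures both syndromes, corrects the bit flip error `û(H u)` and a phase error guessed
from it and the phase syndrome, and inverts the encoding. Its composition with the channel and the
encoder is a convex combination of maps that fix every state, one for each correctly identified
Pauli error, and a remainder, so the error of the code is at most twice the probability of a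
misidentification. The bit flip part of it is `ε`.

For the phase part, let the guess be a phase error that is possible given the bit flip `u` and has
the measured syndrome. It is wrong only if the stabilizers `X^c`, `c ∈ {G y : A y = 0}`, miss the
difference `v + v'` of two possible phase errors. By Poisson summation the probability that `Gᵀ w`
annihilates the random kernel of `A` is a Fourier coefficient of `y ↦ Pr[A y = 0]`, and
two-universality bounds it by `2 · 2^(m-k)`. A union bound over the `s_u` possible phase errors
and the Cauchy–Schwarz inequality give
`∑ p_u √(2 · 2^(m-k) s_u) ≤ √2 · √(∑ p_u² · 2^(m-k) ∑ s_u)`, and the last root is `ε'`: the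
purity of `ω^{XE}` is `2⁻ⁿ ∑ p_u²`, and `ω^E` is diagonal of rank `∑ s_u`.
-/

noncomputable section

namespace PCSS

open scoped Matrix Kronecker

section TraceNorm

open scoped MatrixOrder ComplexOrder Matrix.Norms.L2Operator

variable {a : Type*} [Fintype a] [DecidableEq a]

lemma traceNorm_eq_sum_abs_eigenvalues {M : Matrix a a ℂ} (hM : M.IsHermitian) :
    traceNorm M = ∑ i, |hM.eigenvalues i| := by
  have habs : CFC.abs M = cfc (fun x : ℝ => |x|) M := CFC.abs_eq_cfc_norm M hM
  rw [traceNorm, habs, hM.cfc_eq, Matrix.IsHermitian.cfc, Unitary.conjStarAlgAut_apply,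
    Matrix.trace_mul_cycle]
  simp [Matrix.trace_diagonal]

lemma traceNorm_sub_le {P Q : Matrix a a ℂ} (hP : P.PosSemidef) (hQ : Q.PosSemidef) :
    traceNorm (P - Q) ≤ P.trace.re + Q.trace.re := by
  have hM : (P - Q).IsHermitian := hP.isHermitian.sub hQ.isHermitian
  set V := (hM.eigenvectorUnitary : Matrix a a ℂ)
  have htrace (R : Matrix a a ℂ) : R.trace.re = ∑ i, ((Vᴴ * R * V) i i).re := by
    have hV : V * Vᴴ = 1 := Matrix.mem_unitaryGroup_iff.1 hM.eigenvectorUnitary.2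
    rw [← Complex.re_sum]
    change R.trace.re = (Vᴴ * R * V).trace.re
    rw [Matrix.trace_mul_cycle, hV, Matrix.one_mul]
  have heig (i : a) : hM.eigenvalues i = ((Vᴴ * P * V) i i).re - ((Vᴴ * Q * V) i i).re := by
    have hdiag := hM.conjStarAlgAut_star_eigenvectorUnitary
    rw [Unitary.conjStarAlgAut_star_apply] at hdiag
    change Vᴴ * (P - Q) * V = _ at hdiag
    rw [← Complex.sub_re, ← Matrix.sub_apply, ← Matrix.sub_mul, ← Matrix.mul_sub, hdiag]
    simp
  have hnonneg {R : Matrix a a ℂ} (hR : R.PosSemidef) (i : a) : 0 ≤ ((Vᴴ * R * V) i i).re :=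
    (Complex.le_def.1 (hR.conjTranspose_mul_mul_same V).diag_nonneg).1
  rw [traceNorm_eq_sum_abs_eigenvalues hM, htrace P, htrace Q, ← Finset.sum_add_distrib]
  refine Finset.sum_le_sum fun i _ => ?_
  rw [heig, abs_le]
  constructor <;> linarith [hnonneg hP i, hnonneg hQ i]

end TraceNorm

section Kraus

open scoped ComplexOrder

variable {a b c r ι κ : Type*} [Fintype ι]

/-- The completely positive map `ρ ↦ ∑ wᵢ Mᵢ ρ Mᵢᴴ`. Its weights `wᵢ` are kept apart from the Kraus
operators `Mᵢ`, so that an operator of a composite map can be exactly the identity. -/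
def krausMap [Fintype a] (w : ι → ℝ) (M : ι → Matrix b a ℂ) : Matrix a a ℂ →ₗ[ℂ] Matrix b b ℂ :=
  ∑ i, (w i : ℂ) • sandwich (M i) (M i)ᴴ

lemma krausMap_apply [Fintype a] (w : ι → ℝ) (M : ι → Matrix b a ℂ) (ρ : Matrix a a ℂ) :
    krausMap w M ρ = ∑ i, (w i : ℂ) • (M i * ρ * (M i)ᴴ) := by
  simp [krausMap, sandwich, LinearMap.sum_apply]

lemma krausMap_comp [Fintype a] [Fintype b] [Fintype κ] (w : ι → ℝ) (M : ι → Matrix c b ℂ)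
    (w' : κ → ℝ) (M' : κ → Matrix b a ℂ) :
    krausMap w M ∘ₗ krausMap w' M' =
      krausMap (fun i : ι × κ => w i.1 * w' i.2) fun i => M i.1 * M' i.2 := by
  refine LinearMap.ext fun ρ => ?_
  simp only [LinearMap.comp_apply, krausMap_apply, Fintype.sum_prod_type, Matrix.mul_sum,
    Matrix.sum_mul, Finset.smul_sum, Matrix.mul_smul, Matrix.smul_mul, smul_smul,
    Matrix.conjTranspose_mul, Matrix.mul_assoc, Complex.ofReal_mul]

lemma krausMap_comp_sandwich [Fintype a] [Fintype b] (w : ι → ℝ) (M : ι → Matrix c b ℂ)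
    (A : Matrix b a ℂ) : krausMap w M ∘ₗ sandwich A Aᴴ = krausMap w fun i => M i * A := by
  refine LinearMap.ext fun ρ => ?_
  simp [krausMap_apply, sandwich, Matrix.mul_assoc]

lemma trace_sandwich_of_isometry [Fintype a] [Fintype b] [DecidableEq a] {A : Matrix b a ℂ}
    (hA : Aᴴ * A = 1) (ρ : Matrix a a ℂ) : (sandwich A Aᴴ ρ).trace = ρ.trace := by
  change (A * ρ * Aᴴ).trace = _
  rw [Matrix.trace_mul_comm, ← Matrix.mul_assoc, hA, Matrix.one_mul]

lemma trace_krausMap [Fintype a] [Fintype b] [DecidableEq a] {w : ι → ℝ} {M : ι → Matrix b a ℂ}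
    (h : ∑ i, (w i : ℂ) • ((M i)ᴴ * M i) = 1) (ρ : Matrix a a ℂ) :
    (krausMap w M ρ).trace = ρ.trace := by
  calc (krausMap w M ρ).trace = ((∑ i, (w i : ℂ) • ((M i)ᴴ * M i)) * ρ).trace := by
        simp only [krausMap_apply, Matrix.trace_sum, Matrix.sum_mul, Matrix.trace_smul,
          Matrix.smul_mul, Matrix.trace_mul_cycle (M _) ρ]
    _ = ρ.trace := by rw [h, Matrix.one_mul]

lemma trace_idTensor [Fintype a] [Fintype b] [Fintype r] {T : Matrix a a ℂ →ₗ[ℂ] Matrix b b ℂ}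
    (hT : ∀ ρ, (T ρ).trace = ρ.trace) (ρ : Matrix (r × a) (r × a) ℂ) :
    (idTensor T ρ).trace = ρ.trace := by
  have hblock (i : r) := hT (Matrix.of fun x y => ρ (i, x) (i, y))
  simp only [Matrix.trace, Matrix.diag, Matrix.of_apply] at hblock
  simp only [Matrix.trace, Matrix.diag, Fintype.sum_prod_type, idTensor, Matrix.of_apply, hblock]

lemma idTensor_krausMap [Fintype a] [Fintype r] [DecidableEq r] (w : ι → ℝ)
    (M : ι → Matrix b a ℂ) (ρ : Matrix (r × a) (r × a) ℂ) :
    idTensor (krausMap w M) ρ =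
      ∑ i, (w i : ℂ) • (((1 : Matrix r r ℂ) ⊗ₖ M i) * ρ * ((1 : Matrix r r ℂ) ⊗ₖ M i)ᴴ) := by
  ext i j
  simp only [idTensor, krausMap_apply, Matrix.of_apply, Matrix.sum_apply, Matrix.smul_apply]
  refine Finset.sum_congr rfl fun l _ => congrArg _ ?_
  simp only [Matrix.mul_apply, Matrix.of_apply, Matrix.conjTranspose_apply,
    Matrix.kroneckerMap_apply, Fintype.sum_prod_type, Matrix.one_apply]
  simp [Finset.sum_mul, apply_ite (starRingEnd ℂ), Finset.sum_ite_irrel]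

lemma posSemidef_sum_smul_mul_mul_conjTranspose [Fintype a] [Finite b] {s : Finset κ} {w : κ → ℝ}
    (hw : ∀ i, 0 ≤ w i) (M : κ → Matrix b a ℂ) {ρ : Matrix a a ℂ} (hρ : ρ.PosSemidef) :
    (∑ i ∈ s, (w i : ℂ) • (M i * ρ * (M i)ᴴ)).PosSemidef :=
  Matrix.posSemidef_sum _ fun i _ =>
    (hρ.mul_mul_conjTranspose_same _).smul (Complex.zero_le_real.2 (hw i))

lemma isQuantumOperation_krausMap [Fintype a] [Fintype b] [DecidableEq a] {w : ι → ℝ}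
    (hw : ∀ i, 0 ≤ w i) {M : ι → Matrix b a ℂ} (h : ∑ i, (w i : ℂ) • ((M i)ᴴ * M i) = 1) :
    IsQuantumOperation (krausMap w M) where
  completelyPositive _ ρ hρ := by
    rw [idTensor_krausMap]
    exact posSemidef_sum_smul_mul_mul_conjTranspose hw _ hρ
  tracePreserving := trace_krausMap h

lemma traceNorm_idTensor_krausMap_sub_le [Fintype a] [DecidableEq a] [Fintype r] [DecidableEq r]
    {w : ι → ℝ} (hw : ∀ i, 0 ≤ w i) {M : ι → Matrix a a ℂ}
    (htr : ∀ ρ, (krausMap w M ρ).trace = ρ.trace) {good : Finset ι} (hgood : ∀ i ∈ good, M i = 1)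
    {ρ : Matrix (r × a) (r × a) ℂ} (hρ : ρ.PosSemidef) (hρ1 : ρ.trace = 1) :
    traceNorm (idTensor (krausMap w M) ρ - ρ) ≤ 2 * (1 - ∑ i ∈ good, w i) := by
  classical
  set g := ∑ i ∈ good, w i with hg
  set R := ∑ i ∈ goodᶜ, (w i : ℂ) •
    (((1 : Matrix r r ℂ) ⊗ₖ M i) * ρ * ((1 : Matrix r r ℂ) ⊗ₖ M i)ᴴ) with hR
  have hRpos : R.PosSemidef := posSemidef_sum_smul_mul_mul_conjTranspose hw _ hρ
  have hsplit : idTensor (krausMap w M) ρ = (g : ℂ) • ρ + R := by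
    rw [idTensor_krausMap, ← Finset.sum_add_sum_compl good, hR, hg, Complex.ofReal_sum,
      Finset.sum_smul]
    refine congrArg (· + _) (Finset.sum_congr rfl fun i hi => ?_)
    simp [hgood i hi]
  have hRtr : R.trace = ((1 - g : ℝ) : ℂ) := by
    have h := trace_idTensor htr ρ
    rw [hsplit, Matrix.trace_add, Matrix.trace_smul, hρ1, smul_eq_mul, mul_one] at h
    rw [Complex.ofReal_sub, Complex.ofReal_one, ← h, add_sub_cancel_left]
  have hg1 : 0 ≤ ((1 - g : ℝ) : ℂ) := hRtr ▸ hRpos.trace_nonneg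
  have hdiff : idTensor (krausMap w M) ρ - ρ = R - ((1 - g : ℝ) : ℂ) • ρ := by
    rw [hsplit, Complex.ofReal_sub, Complex.ofReal_one, sub_smul, one_smul]
    abel
  rw [hdiff]
  refine (traceNorm_sub_le hRpos (hρ.smul hg1)).trans_eq ?_
  rw [Matrix.trace_smul, hρ1, hRtr, smul_eq_mul, mul_one, Complex.ofReal_re, two_mul]

end Kraus

open scoped ComplexOrder in
lemma posSemidef_ketbra {a : Type*} [Finite a] (ψ : a → ℂ) : (ketbra ψ).PosSemidef :=
  Matrix.posSemidef_vecMulVec_self_star ψ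

lemma trace_ketbra_ebits (m : ℕ) : (ketbra (ebits m)).trace = 1 := by
  have hamp : ((1 / √(2 ^ m) : ℝ) : ℂ) * ((1 / √(2 ^ m) : ℝ) : ℂ) = 1 / 2 ^ m := by
    rw [← Complex.ofReal_mul, div_mul_div_comm, Real.mul_self_sqrt (by positivity)]
    simp
  simp only [Matrix.trace, Matrix.diag, ketbra, Matrix.vecMulVec_apply, Pi.star_apply, ebits,
    Fintype.sum_prod_type, apply_ite (star : ℂ → ℂ), star_zero, mul_ite, ite_mul, zero_mul,
    mul_zero, Finset.sum_ite_eq, Finset.mem_univ, if_true, RCLike.star_def, Complex.conj_ofReal,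
    hamp]
  simp

section CharTwo

variable {G : Type*} [AddCommGroup G] [Module (ZMod 2) G] {x y z : G}

lemma add_add_cancel_self (x y : G) : x + y + y = x := by
  rw [add_assoc, ZModModule.add_self, add_zero]

lemma add_eq_zero_iff_eq : x + y = 0 ↔ x = y := by
  rw [← ZModModule.sub_eq_add, sub_eq_zero]

lemma eq_add_iff_add_eq : x = y + z ↔ x + z = y := by
  rw [← ZModModule.sub_eq_add y, eq_sub_iff_add_eq]

end CharTwo

section Sign

variable {n k : ℕ}

lemma neg_one_pow_val_add (a b : ZMod 2) :
    (-1 : ℂ) ^ (a + b).val = (-1) ^ a.val * (-1) ^ b.val := by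
  rw [← pow_add, ZMod.val_add, neg_one_pow_eq_pow_mod_two (n := a.val + b.val)]

lemma sign_add_left (x y v : Bits n) : sign (x + y) v = sign x v * sign y v := by
  simp only [sign, add_dotProduct, neg_one_pow_val_add]

lemma sign_add_right (x v w : Bits n) : sign x (v + w) = sign x v * sign x w := by
  simp only [sign, dotProduct_add, neg_one_pow_val_add]

lemma sign_comm (x v : Bits n) : sign x v = sign v x := by
  simp only [sign, dotProduct_comm]

@[simp] lemma sign_zero_left (v : Bits n) : sign 0 v = 1 := by simp [sign]

@[simp] lemma sign_zero_right (v : Bits n) : sign v 0 = 1 := by simp [sign]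

lemma sign_eq_one_or (x v : Bits n) : sign x v = 1 ∨ sign x v = -1 :=
  neg_one_pow_eq_or ℂ _

@[simp] lemma sign_mul_self (x v : Bits n) : sign x v * sign x v = 1 := by
  rcases sign_eq_one_or x v with h | h <;> simp [h]

@[simp] lemma conj_sign (x v : Bits n) : (starRingEnd ℂ) (sign x v) = sign x v := by
  rcases sign_eq_one_or x v with h | h <;> simp [h]

lemma abs_re_sign_le_one (x v : Bits n) : |(sign x v).re| ≤ 1 := by
  rcases sign_eq_one_or x v with h | h <;> simp [h]

lemma sign_eq_one_iff {x v : Bits n} : sign x v = 1 ↔ x ⬝ᵥ v = 0 := by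
  rw [sign, neg_one_pow_eq_one_iff_even (by norm_num)]
  generalize x ⬝ᵥ v = a
  decide +revert

lemma sign_mulVec (M : Matrix (Fin n) (Fin k) (ZMod 2)) (y : Bits k) (v : Bits n) :
    sign (M *ᵥ y) v = sign y (Mᵀ *ᵥ v) := by
  rw [sign, sign, Matrix.dotProduct_mulVec, Matrix.vecMul_transpose]

end Sign

section Annihilator

variable {n : ℕ} {s : Finset (Bits n)} {w : Bits n}

/-- The bit strings orthogonal to every element of `s`; when `s` is a linear code this is its dual
code. -/
def annihilator (s : Finset (Bits n)) : Finset (Bits n) := {w | ∀ x ∈ s, x ⬝ᵥ w = 0}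

lemma mem_annihilator : w ∈ annihilator s ↔ ∀ x ∈ s, x ⬝ᵥ w = 0 := by
  simp [annihilator]

lemma sign_eq_one_of_mem_annihilator (hw : w ∈ annihilator s) {x : Bits n} (hx : x ∈ s) :
    sign x w = 1 :=
  sign_eq_one_iff.2 (mem_annihilator.1 hw x hx)

lemma mem_annihilator_univ : w ∈ annihilator Finset.univ ↔ w = 0 := by
  refine ⟨fun h => funext fun i => ?_, fun h => mem_annihilator.2 fun x _ => by simp [h]⟩
  simpa using mem_annihilator.1 h (Pi.single i 1) (Finset.mem_univ _)

lemma card_annihilator_ne_zero : (annihilator s).card ≠ 0 :=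
  Finset.card_ne_zero.2 ⟨0, mem_annihilator.2 fun x _ => dotProduct_zero x⟩

lemma sum_sign_eq (hs : ∀ x ∈ s, ∀ y ∈ s, x + y ∈ s) (w : Bits n) :
    ∑ x ∈ s, sign x w = if w ∈ annihilator s then (s.card : ℂ) else 0 := by
  split_ifs with h
  · rw [Finset.sum_congr rfl fun x hx => sign_eq_one_of_mem_annihilator h hx]
    simp
  · obtain ⟨a, ha, haw⟩ : ∃ a ∈ s, a ⬝ᵥ w ≠ 0 := by simpa [mem_annihilator] using h
    have hsign : sign a w = -1 := (sign_eq_one_or a w).resolve_left (mt sign_eq_one_iff.1 haw)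
    refine Finset.sum_involution (fun x _ => x + a) (fun x _ => ?_) (fun x _ _ hxa => haw ?_)
      (fun x hx => hs x hx a ha) fun x _ => add_add_cancel_self x a
    · rw [sign_add_left, hsign, mul_neg_one, add_neg_cancel]
    · rw [add_eq_left.1 hxa, zero_dotProduct]

lemma sum_univ_sign (w : Bits n) : ∑ x, sign x w = if w = 0 then (2 : ℂ) ^ n else 0 := by
  simp [sum_sign_eq fun x _ y _ => Finset.mem_univ (x + y), mem_annihilator_univ]

-- Double counting of `∑ sign x w` over `x ∈ s` and all `w`.
lemma card_annihilator_mul_card (hs : ∀ x ∈ s, ∀ y ∈ s, x + y ∈ s) (h0 : 0 ∈ s) :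
    ((annihilator s).card * s.card : ℂ) = 2 ^ n := by
  calc ((annihilator s).card * s.card : ℂ) = ∑ w, ∑ x ∈ s, sign x w := by
        simp [sum_sign_eq hs]
    _ = ∑ x ∈ s, ∑ w, sign w x := by
        rw [Finset.sum_comm]
        simp only [sign_comm]
    _ = 2 ^ n := by simp [sum_univ_sign, h0]

end Annihilator

section Hash

variable {k m : ℕ} {f : Bits k → Bits m}

/-- The direction of the fibers of an affine function `f`, i.e. the kernel of its linear part `A`,
recovered from `f` itself because `A y = f(y) - f(0)`. -/
def hashKernel (f : Bits k → Bits m) : Finset (Bits k) := {y | f y = f 0}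

lemma mem_hashKernel {y : Bits k} : y ∈ hashKernel f ↔ f y = f 0 := by
  simp [hashKernel]

lemma zero_mem_hashKernel : 0 ∈ hashKernel f :=
  mem_hashKernel.2 rfl

namespace IsFullRankAffine

lemma apply_eq_apply_iff (hf : IsFullRankAffine f) {y y' : Bits k} :
    f y = f y' ↔ y + y' ∈ hashKernel f := by
  obtain ⟨A, s₀, -, h⟩ := hf
  rw [mem_hashKernel, h, h, h, h, Matrix.mulVec_zero, Matrix.mulVec_add, add_left_inj,
    add_left_inj, add_eq_zero_iff_eq]

lemma add_mem_hashKernel (hf : IsFullRankAffine f) :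
    ∀ y ∈ hashKernel f, ∀ y' ∈ hashKernel f, y + y' ∈ hashKernel f := fun y hy y' hy' => by
  rw [← hf.apply_eq_apply_iff, mem_hashKernel.1 hy, mem_hashKernel.1 hy']

lemma surjective (hf : IsFullRankAffine f) : Function.Surjective f := by
  obtain ⟨A, s₀, hA, h⟩ := hf
  have htop : LinearMap.range A.mulVecLin = ⊤ := by
    apply Submodule.eq_top_of_finrank_eq
    rw [← Matrix.rank, hA, Module.finrank_fin_fun]
  intro s
  obtain ⟨y, hy⟩ := LinearMap.range_eq_top.1 htop (s + s₀)
  exact ⟨y, by rw [h, ← Matrix.mulVecLin_apply, hy, add_add_cancel_self]⟩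

lemma card_fiber_eq_card_hashKernel (hf : IsFullRankAffine f) (s : Bits m) :
    (Finset.univ.filter fun y => f y = s).card = (hashKernel f).card := by
  obtain ⟨y₀, rfl⟩ := hf.surjective s
  refine Finset.card_bij' (fun y _ => y + y₀) (fun y _ => y + y₀) (fun y hy => ?_)
    (fun y hy => ?_) (fun y _ => add_add_cancel_self y y₀) fun y _ => add_add_cancel_self y y₀
  · exact hf.apply_eq_apply_iff.1 (Finset.mem_filter.1 hy).2
  · rwa [Finset.mem_filter_univ, hf.apply_eq_apply_iff, add_add_cancel_self]

lemma two_pow_mul_card_fiber (hf : IsFullRankAffine f) (s : Bits m) :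
    2 ^ m * (Finset.univ.filter fun y => f y = s).card = 2 ^ k := by
  calc 2 ^ m * (Finset.univ.filter fun y => f y = s).card
      = ∑ s, (Finset.univ.filter fun y => f y = s).card := by
        simp [hf.card_fiber_eq_card_hashKernel]
    _ = Fintype.card (Bits k) :=
        (Finset.card_eq_sum_card_fiberwise fun _ _ => Finset.mem_coe.2 (Finset.mem_univ _)).symm
    _ = 2 ^ k := by simp

lemma cast_card_hashKernel {R : Type*} [Field R] [CharZero R] (hf : IsFullRankAffine f) :
    ((hashKernel f).card : R) = 2 ^ k / 2 ^ m := by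
  rw [eq_div_iff (pow_ne_zero _ two_ne_zero), mul_comm]
  exact_mod_cast hf.two_pow_mul_card_fiber (f 0)

end IsFullRankAffine

lemma sum_toReal_eq_one {α : Type*} [Fintype α] (P : PMF α) : ∑ a, (P a).toReal = 1 := by
  rw [← ENNReal.toReal_sum fun a _ => P.apply_ne_top a, ← tsum_fintype (L := .unconditional α),
    P.tsum_coe, ENNReal.toReal_one]

lemma sum_toReal_mul_mono {α : Type*} [Fintype α] (P : PMF α) {g h : α → ℝ}
    (hgh : ∀ a ∈ P.support, g a ≤ h a) :
    ∑ a, (P a).toReal * g a ≤ ∑ a, (P a).toReal * h a := by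
  refine Finset.sum_le_sum fun a _ => ?_
  by_cases ha : a ∈ P.support
  · exact mul_le_mul_of_nonneg_left (hgh a ha) ENNReal.toReal_nonneg
  · simp [(P.apply_eq_zero_iff a).2 ha]

/-- The probability `Pr[f(y) = f(0)]` that `y` lies in the random kernel. -/
def kernelProb (P : PMF (Bits k → Bits m)) (y : Bits k) : ℝ :=
  ∑ f with y ∈ hashKernel f, (P f).toReal

/-- The probability that `w` lies in the annihilator of the random kernel. -/
def annihilatorProb (P : PMF (Bits k → Bits m)) (w : Bits k) : ℝ :=
  ∑ f with w ∈ annihilator (hashKernel f), (P f).toReal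

variable {P : PMF (Bits k → Bits m)}

lemma kernelProb_zero : kernelProb P 0 = 1 := by
  simp [kernelProb, zero_mem_hashKernel, sum_toReal_eq_one]

lemma IsTwoUniversal.kernelProb_le (hP : IsTwoUniversal P) {y : Bits k} (hy : y ≠ 0) :
    kernelProb P y ≤ 1 / 2 ^ m := by
  simpa [kernelProb, mem_hashKernel] using hP y 0 hy

lemma sum_kernelProb_mul (g : Bits k → ℝ) :
    ∑ y, kernelProb P y * g y = ∑ f, (P f).toReal * ∑ y ∈ hashKernel f, g y := by
  simp only [kernelProb, Finset.sum_filter, Finset.sum_mul, ite_mul, zero_mul, Finset.mul_sum]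
  rw [Finset.sum_comm]
  simp

/-- Poisson summation, averaged over `f`. -/
lemma sum_kernelProb_mul_sign (hA : ∀ f ∈ P.support, IsFullRankAffine f) (w : Bits k) :
    ∑ y, kernelProb P y * (sign y w).re = 2 ^ k / 2 ^ m * annihilatorProb P w := by
  rw [sum_kernelProb_mul, annihilatorProb, Finset.sum_filter, Finset.mul_sum]
  refine Finset.sum_congr rfl fun f _ => ?_
  by_cases hf : f ∈ P.support
  · rw [← Complex.re_sum, sum_sign_eq (hA f hf).add_mem_hashKernel, apply_ite Complex.re,
      Complex.natCast_re, (hA f hf).cast_card_hashKernel]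
    split_ifs <;> simp [mul_comm]
  · simp [(P.apply_eq_zero_iff f).2 hf]

lemma sum_kernelProb (hA : ∀ f ∈ P.support, IsFullRankAffine f) :
    ∑ y, kernelProb P y = 2 ^ k / 2 ^ m := by
  simpa [annihilatorProb, mem_annihilator, sum_toReal_eq_one] using sum_kernelProb_mul_sign hA 0

/-- Two-universality bounds the kernel probabilities, and hence their Fourier transform: for
`y ≠ 0` the excess `kernelProb P y - 2⁻ᵐ` is nonpositive, so replacing its sign by `-1` bounds the
transform by the sum of the kernel probabilities, which is known. -/
lemma IsTwoUniversal.annihilatorProb_le (hP : IsTwoUniversal P)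
    (hA : ∀ f ∈ P.support, IsFullRankAffine f) {w : Bits k} (hw : w ≠ 0) :
    annihilatorProb P w ≤ 2 * (2 ^ m / 2 ^ k) := by
  have hzero : ∑ y : Bits k, (sign y w).re = 0 := by
    rw [← Complex.re_sum, sum_univ_sign, if_neg hw, Complex.zero_re]
  have hterm (y : Bits k) : (kernelProb P y - 1 / 2 ^ m) * (sign y w).re ≤
      (1 / 2 ^ m - kernelProb P y) + if y = 0 then 2 * (1 - 1 / 2 ^ m) else 0 := by
    split_ifs with hy
    · rw [hy, kernelProb_zero, sign_zero_left, Complex.one_re]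
      linarith
    · nlinarith [hP.kernelProb_le hy, (abs_le.1 (abs_re_sign_le_one y w)).1]
  have hfourier : 2 ^ k / 2 ^ m * annihilatorProb P w ≤ 2 := by
    calc 2 ^ k / 2 ^ m * annihilatorProb P w
        = ∑ y, (kernelProb P y - 1 / 2 ^ m) * (sign y w).re := by
          simp [sub_mul, ← Finset.mul_sum, hzero, sum_kernelProb_mul_sign hA]
      _ ≤ _ := Finset.sum_le_sum fun y _ => hterm y
      _ = 2 * (1 - 1 / 2 ^ m) := by
          rw [Finset.sum_add_distrib, Finset.sum_sub_distrib, sum_kernelProb hA]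
          simp [div_eq_mul_inv]
      _ ≤ 2 := by linarith [show (0 : ℝ) ≤ 1 / 2 ^ m by positivity]
  rw [← inv_div, ← div_eq_mul_inv, le_div_iff₀' (by positivity)]
  exact hfourier

end Hash

section Pauli

variable {n : ℕ}

lemma pauliX_apply (u x y : Bits n) : pauliX u x y = if x + u = y then 1 else 0 := by
  simp only [pauliX, Matrix.of_apply, eq_add_iff_add_eq]

lemma pauliX_mul_apply {b : Type*} (u : Bits n) (A : Matrix (Bits n) b ℂ) (x : Bits n) (j : b) :
    (pauliX u * A) x j = A (x + u) j := by
  simp [Matrix.mul_apply, pauliX_apply]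

lemma mul_pauliX_apply {b : Type*} (A : Matrix b (Bits n) ℂ) (u : Bits n) (j : b) (x : Bits n) :
    (A * pauliX u) j x = A j (x + u) := by
  simp [Matrix.mul_apply, pauliX]

lemma pauliX_mulVec_apply (u : Bits n) (ψ : Bits n → ℂ) (x : Bits n) :
    (pauliX u *ᵥ ψ) x = ψ (x + u) := by
  simp [Matrix.mulVec, dotProduct, pauliX_apply]

lemma pauliX_mul_self (u : Bits n) : pauliX u * pauliX u = 1 := by
  ext x y
  rw [pauliX_mul_apply, pauliX_apply, add_add_cancel_self, Matrix.one_apply]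

lemma pauliZ_mul (v w : Bits n) : pauliZ v * pauliZ w = pauliZ (v + w) := by
  simp [pauliZ, sign_add_right]

lemma pauliZ_zero : pauliZ (0 : Bits n) = 1 := by
  simp [pauliZ]

lemma conjTranspose_pauliX (u : Bits n) : (pauliX u)ᴴ = pauliX u := by
  ext x y
  have hswap : y + u = x ↔ x + u = y := by rw [← eq_add_iff_add_eq, eq_comm]
  simp [pauliX_apply, hswap]

lemma conjTranspose_pauliZ (v : Bits n) : (pauliZ v)ᴴ = pauliZ v := by
  simp [pauliZ, Matrix.diagonal_conjTranspose, Pi.star_def]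

lemma conjTranspose_pauli (u v : Bits n) : (pauliX u * pauliZ v)ᴴ = pauliZ v * pauliX u := by
  rw [Matrix.conjTranspose_mul, conjTranspose_pauliX, conjTranspose_pauliZ]

lemma conjTranspose_pauli_mul_pauli (u v w : Bits n) :
    (pauliX u * pauliZ v)ᴴ * (pauliX u * pauliZ w) = pauliZ (v + w) := by
  rw [conjTranspose_pauli, Matrix.mul_assoc, ← Matrix.mul_assoc (pauliX u), pauliX_mul_self,
    Matrix.one_mul, pauliZ_mul]

lemma pauli_mul_mul_conjTranspose_apply (u v : Bits n) (M : Matrix (Bits n) (Bits n) ℂ)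
    (x y : Bits n) : ((pauliX u * pauliZ v) * M * (pauliX u * pauliZ v)ᴴ) x y =
      sign (x + y) v * M (x + u) (y + u) := by
  have hsign : sign (x + u) v * sign (y + u) v = sign (x + y) v := by
    rw [← sign_add_left, add_comm y, ZModModule.add_add_add_cancel]
  rw [conjTranspose_pauli, ← Matrix.mul_assoc, mul_pauliX_apply, Matrix.mul_assoc, Matrix.mul_assoc,
    pauliX_mul_apply, ← Matrix.mul_assoc, pauliZ, Matrix.mul_diagonal, Matrix.diagonal_mul,
    mul_right_comm, hsign]

namespace PauliChannel

variable (N : PauliChannel n)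

lemma toLinearMap_eq_krausMap : N.toLinearMap =
    krausMap (fun i : Bits n × Bits n => N.p i.1 i.2) fun i => pauliX i.1 * pauliZ i.2 := by
  simp only [toLinearMap, krausMap, Fintype.sum_prod_type, conjTranspose_pauli]

lemma trace_toLinearMap (ρ : Matrix (Bits n) (Bits n) ℂ) : (N.toLinearMap ρ).trace = ρ.trace := by
  rw [N.toLinearMap_eq_krausMap]
  refine trace_krausMap ?_ ρ
  simp only [conjTranspose_pauli_mul_pauli, ZModModule.add_self, pauliZ_zero, ← Finset.sum_smul,
    ← Complex.ofReal_sum, Fintype.sum_prod_type, N.sum_eq_one, Complex.ofReal_one, one_smul]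

end PauliChannel

end Pauli

section Amplitude

/-- The amplitude `2^{-(k-m)/2}` of a codeword. -/
def amplitude (k m : ℕ) : ℂ := ((1 / √(2 ^ ((k : ℤ) - (m : ℤ))) : ℝ) : ℂ)

variable {k m : ℕ}

lemma amplitude_ne_zero : amplitude k m ≠ 0 :=
  Complex.ofReal_ne_zero.2 (by positivity)

lemma amplitude_mul_star : amplitude k m * star (amplitude k m) = 2 ^ m / 2 ^ k := by
  rw [amplitude, RCLike.star_def, Complex.conj_ofReal, ← Complex.ofReal_mul, div_mul_div_comm,
    Real.mul_self_sqrt (by positivity), zpow_sub₀ two_ne_zero]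
  simp

end Amplitude

namespace ClassicalCode

section Encoder

variable {n k m : ℕ} (K : ClassicalCode n k) {f : Bits k → Bits m}

lemma mulVec_injective : Function.Injective fun y => K.G *ᵥ y := by
  have hrank := LinearMap.finrank_range_add_finrank_ker K.G.mulVecLin
  rw [K.range_G, K.finrank_eq, Module.finrank_fin_fun, Nat.add_eq_left] at hrank
  exact LinearMap.ker_eq_bot.1 (Submodule.finrank_eq_zero.1 hrank)

lemma parity_eq_zero_iff {x : Bits n} : K.H *ᵥ x = 0 ↔ ∃ y, K.G *ᵥ y = x := by
  have hexact : x ∈ LinearMap.ker K.H.mulVecLin ↔ x ∈ LinearMap.range K.G.mulVecLin := by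
    rw [K.ker_H, K.range_G]
  exact hexact

lemma parity_mulVec (y : Bits k) : K.H *ᵥ (K.G *ᵥ y) = 0 :=
  K.parity_eq_zero_iff.2 ⟨y, rfl⟩

lemma sum_eq_sum_mulVec {g : Bits n → ℂ} (hg : ∀ x, K.H *ᵥ x ≠ 0 → g x = 0) :
    ∑ x, g x = ∑ y, g (K.G *ᵥ y) :=
  (Fintype.sum_of_injective _ K.mulVec_injective _ _
    (fun x hx => hg x (mt K.parity_eq_zero_iff.1 hx)) fun _ => rfl).symm

/-- The code `C' = {G y : A y = 0}` of the stabilizers `X^c`. -/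
def xCode (f : Bits k → Bits m) : Finset (Bits n) := (hashKernel f).image (K.G *ᵥ ·)

lemma mem_xCode_iff_mem_cosetSet {x : Bits n} : x ∈ K.xCode f ↔ x ∈ K.cosetSet f (f 0) := by
  simp only [xCode, Finset.mem_image, mem_hashKernel, cosetSet, Set.mem_ofPred_eq, and_comm,
    eq_comm (a := x)]

lemma mulVec_mem_xCode {y : Bits k} : K.G *ᵥ y ∈ K.xCode f ↔ y ∈ hashKernel f :=
  K.mulVec_injective.mem_finset_image

lemma parity_of_mem_xCode {x : Bits n} (hx : x ∈ K.xCode f) : K.H *ᵥ x = 0 := by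
  obtain ⟨y, -, rfl⟩ := Finset.mem_image.1 hx
  exact K.parity_mulVec y

lemma zero_mem_xCode : 0 ∈ K.xCode f := by
  rw [← Matrix.mulVec_zero K.G, K.mulVec_mem_xCode]
  exact zero_mem_hashKernel

lemma add_mem_xCode (hf : IsFullRankAffine f) :
    ∀ x ∈ K.xCode f, ∀ x' ∈ K.xCode f, x + x' ∈ K.xCode f := by
  intro x hx x' hx'
  obtain ⟨y, hy, rfl⟩ := Finset.mem_image.1 hx
  obtain ⟨y', hy', rfl⟩ := Finset.mem_image.1 hx'
  rw [← Matrix.mulVec_add, K.mulVec_mem_xCode]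
  exact hf.add_mem_hashKernel y hy y' hy'

lemma card_xCode : (K.xCode f).card = (hashKernel f).card :=
  Finset.card_image_of_injective _ K.mulVec_injective

lemma mem_annihilator_xCode {v : Bits n} :
    v ∈ annihilator (K.xCode f) ↔ K.Gᵀ *ᵥ v ∈ annihilator (hashKernel f) := by
  simp only [mem_annihilator, xCode, Finset.forall_mem_image, Matrix.dotProduct_mulVec,
    Matrix.vecMul_transpose]

/-- The matrix whose columns are the codewords. -/
def encoder (f : Bits k → Bits m) : Matrix (Bits n) (Bits m) ℂ :=
  Matrix.of fun x s => K.codeword f s x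

lemma encoder_mulVec_apply (y : Bits k) (s : Bits m) :
    K.encoder f (K.G *ᵥ y) s = if f y = s then amplitude k m else 0 := by
  have hmem : K.G *ᵥ y ∈ K.cosetSet f s ↔ f y = s :=
    ⟨fun ⟨_, h, hs⟩ => K.mulVec_injective h ▸ hs, fun h => ⟨y, rfl, h⟩⟩
  simp only [encoder, Matrix.of_apply, codeword, hmem, amplitude]

lemma encoder_apply_eq_zero {x : Bits n} (hx : K.H *ᵥ x ≠ 0) (s : Bits m) :
    K.encoder f x s = 0 :=
  if_neg fun ⟨y, hy, _⟩ => hx (hy ▸ K.parity_mulVec y)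

lemma encoder_isometry (hf : IsFullRankAffine f) : (K.encoder f)ᴴ * K.encoder f = 1 := by
  ext s s'
  rw [Matrix.mul_apply, K.sum_eq_sum_mulVec fun x hx => by
    rw [K.encoder_apply_eq_zero hx s', mul_zero]]
  simp only [Matrix.conjTranspose_apply, encoder_mulVec_apply, apply_ite star, star_zero]
  by_cases hs : s = s'
  · have hcard : (2 ^ m : ℂ) * (Finset.univ.filter fun y => f y = s').card = 2 ^ k :=
      mod_cast hf.two_pow_mul_card_fiber s'
    rw [hs, Matrix.one_apply_eq]
    calc (∑ y, (if f y = s' then star (amplitude k m) else 0) *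
          if f y = s' then amplitude k m else 0)
        = ∑ y, if f y = s' then (2 ^ m / 2 ^ k : ℂ) else 0 := by
          simp only [ite_zero_mul_ite_zero, and_self, mul_comm (star _), amplitude_mul_star]
      _ = 2 ^ m * (Finset.univ.filter fun y => f y = s').card / 2 ^ k := by
          rw [← Finset.sum_filter, Finset.sum_const, nsmul_eq_mul]
          ring
      _ = 1 := by rw [hcard, div_self (pow_ne_zero _ two_ne_zero)]
  · rw [Matrix.one_apply_ne hs]
    refine Finset.sum_eq_zero fun y _ => ?_
    rw [ite_zero_mul_ite_zero, if_neg fun h => hs (h.1.symm.trans h.2)]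

lemma encoder_mul_conjTranspose_apply (hf : IsFullRankAffine f) (x x' : Bits n) :
    (K.encoder f * (K.encoder f)ᴴ) x x' =
      if K.H *ᵥ x = 0 ∧ x + x' ∈ K.xCode f then 2 ^ m / 2 ^ k else 0 := by
  simp only [Matrix.mul_apply, Matrix.conjTranspose_apply]
  by_cases hx : K.H *ᵥ x = 0
  · by_cases hx' : K.H *ᵥ x' = 0
    · obtain ⟨y, rfl⟩ := K.parity_eq_zero_iff.1 hx
      obtain ⟨y', rfl⟩ := K.parity_eq_zero_iff.1 hx'
      simp only [encoder_mulVec_apply, apply_ite star, star_zero, ite_mul, zero_mul,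
        Finset.sum_ite_eq, Finset.mem_univ, if_true, mul_ite, mul_zero, amplitude_mul_star, hx,
        true_and, ← Matrix.mulVec_add, mulVec_mem_xCode, ← hf.apply_eq_apply_iff]
    · rw [if_neg fun h => hx' <| by simpa [Matrix.mulVec_add, hx] using K.parity_of_mem_xCode h.2]
      exact Finset.sum_eq_zero fun s _ => by rw [K.encoder_apply_eq_zero hx', star_zero, mul_zero]
  · rw [if_neg fun h => hx h.1]
    exact Finset.sum_eq_zero fun s _ => by rw [K.encoder_apply_eq_zero hx, zero_mul]

end Encoder

section CodeSpace

variable {n k m : ℕ} (K : ClassicalCode n k) {f : Bits k → Bits m}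

lemma pauliZ_mul_encoder {v : Bits n} (hv : K.Gᵀ *ᵥ v = 0) :
    pauliZ v * K.encoder f = K.encoder f := by
  ext x s
  rw [pauliZ, Matrix.diagonal_mul]
  by_cases hx : K.H *ᵥ x = 0
  · obtain ⟨y, rfl⟩ := K.parity_eq_zero_iff.1 hx
    rw [sign_mulVec, hv, sign_zero_right, one_mul]
  · rw [K.encoder_apply_eq_zero hx, mul_zero]

lemma transpose_mulVec_row (i : Fin (n - k)) : K.Gᵀ *ᵥ K.H i = 0 := by
  ext j
  have hcol := congrFun (K.parity_mulVec (Pi.single j 1)) i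
  rw [Matrix.mulVec_single_one] at hcol
  exact (dotProduct_comm _ _).trans hcol

lemma pauliX_mul_encoder (hf : IsFullRankAffine f) {c : Bits n} (hc : c ∈ K.xCode f) :
    pauliX c * K.encoder f = K.encoder f := by
  ext x s
  rw [pauliX_mul_apply]
  by_cases hx : K.H *ᵥ x = 0
  · obtain ⟨y, hy, rfl⟩ := Finset.mem_image.1 hc
    obtain ⟨z, rfl⟩ := K.parity_eq_zero_iff.1 hx
    have hfz : f (z + y) = f z := by
      rwa [hf.apply_eq_apply_iff, add_comm z, add_add_cancel_self]
    rw [← Matrix.mulVec_add, encoder_mulVec_apply, encoder_mulVec_apply, hfz]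
  · rw [K.encoder_apply_eq_zero hx, K.encoder_apply_eq_zero]
    rwa [Matrix.mulVec_add, K.parity_of_mem_xCode hc, add_zero]

lemma apply_eq_zero_of_pauliZ_mulVec {ψ : Bits n → ℂ} (hψ : ∀ i, pauliZ (K.H i) *ᵥ ψ = ψ)
    {x : Bits n} (hx : K.H *ᵥ x ≠ 0) : ψ x = 0 := by
  obtain ⟨i, hi⟩ := Function.ne_iff.1 hx
  have hsign : sign x (K.H i) = -1 :=
    (sign_eq_one_or _ _).resolve_left fun h => hi (by rwa [sign_comm, sign_eq_one_iff] at h)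
  have hneg := congrFun (hψ i) x
  rw [pauliZ, Matrix.mulVec_diagonal, hsign, neg_one_mul] at hneg
  exact CharZero.neg_eq_self_iff.1 hneg

lemma apply_mulVec_eq_of_pauliX_mulVec (hf : IsFullRankAffine f) {ψ : Bits n → ℂ}
    (hψ : ∀ c ∈ K.xCode f, pauliX c *ᵥ ψ = ψ) {y y' : Bits k} (hy : f y = f y') :
    ψ (K.G *ᵥ y) = ψ (K.G *ᵥ y') := by
  have hinv := congrFun (hψ _ (K.mulVec_mem_xCode.2 (hf.apply_eq_apply_iff.1 hy))) (K.G *ᵥ y')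
  rwa [pauliX_mulVec_apply, ← Matrix.mulVec_add, add_comm y', add_add_cancel_self] at hinv

lemma mem_range_encoder_iff (hf : IsFullRankAffine f) {ψ : Bits n → ℂ} :
    ψ ∈ LinearMap.range (K.encoder f).mulVecLin ↔
      (∀ i, pauliZ (K.H i) *ᵥ ψ = ψ) ∧ ∀ c ∈ K.xCode f, pauliX c *ᵥ ψ = ψ := by
  constructor
  · rintro ⟨φ, rfl⟩
    simp only [Matrix.mulVecLin_apply, Matrix.mulVec_mulVec]
    exact ⟨fun i => by rw [K.pauliZ_mul_encoder (K.transpose_mulVec_row i)],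
      fun c hc => by rw [K.pauliX_mul_encoder hf hc]⟩
  · rintro ⟨hZ, hX⟩
    choose g hg using hf.surjective
    refine ⟨fun s => (amplitude k m)⁻¹ * ψ (K.G *ᵥ g s), funext fun x => ?_⟩
    simp only [Matrix.mulVecLin_apply, Matrix.mulVec, dotProduct]
    by_cases hx : K.H *ᵥ x = 0
    · obtain ⟨y, rfl⟩ := K.parity_eq_zero_iff.1 hx
      simp only [encoder_mulVec_apply, ite_mul, zero_mul, Finset.sum_ite_eq, Finset.mem_univ,
        if_true, mul_inv_cancel_left₀ amplitude_ne_zero]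
      exact K.apply_mulVec_eq_of_pauliX_mulVec hf hX (hg _)
    · rw [K.apply_eq_zero_of_pauliZ_mulVec hZ hx]
      exact Finset.sum_eq_zero fun s _ => by rw [K.encoder_apply_eq_zero hx, zero_mul]

end CodeSpace

end ClassicalCode

section Decoder

lemma exists_rightInverse_mem {α β : Type*} {φ : α → β} (hφ : Function.Surjective φ) (s : Set α) :
    ∃ g : β → α, Function.RightInverse g φ ∧ ∀ a ∈ s, g (φ a) ∈ s := by
  have h (b : β) : ∃ a, φ a = b ∧ ∀ a' ∈ s, φ a' = b → a ∈ s := by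
    by_cases hb : ∃ a, φ a = b ∧ a ∈ s
    · obtain ⟨a, hab, ha⟩ := hb
      exact ⟨a, hab, fun _ _ _ => ha⟩
    · obtain ⟨a, ha⟩ := hφ b
      exact ⟨a, ha, fun a' ha' hb' => absurd ⟨a', hb', ha'⟩ hb⟩
  choose g hg hgs using h
  exact ⟨g, hg, fun a ha => hgs (φ a) a ha rfl⟩

variable {n k m : ℕ}

/-- A rule guessing the phase error from the bit flip error `u` and the phase syndrome. The
syndrome is represented by any phase error `v` having it, two of them having the same syndrome when
their sum commutes with all stabilizers `X^c`. -/
structure PhaseEstimator (K : ClassicalCode n k) (f : Bits k → Bits m) where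
  est : Bits n → Bits n → Bits n
  est_add_mem : ∀ u v, est u v + v ∈ annihilator (K.xCode f)
  est_congr : ∀ u v v', v + v' ∈ annihilator (K.xCode f) → est u v = est u v'

namespace PhaseEstimator

variable {K : ClassicalCode n k} {f : Bits k → Bits m}

/-- The guess is a possible phase error whenever the phase syndrome has one. -/
def IsPlausible (D : PhaseEstimator K f) (N : PauliChannel n) : Prop :=
  ∀ u v, N.p u v ≠ 0 → N.p u (D.est u v) ≠ 0

variable (K f) in
lemma exists_isPlausible (N : PauliChannel n) : ∃ D : PhaseEstimator K f, D.IsPlausible N := by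
  let syndrome := Set.rangeFactorization fun (v : Bits n) (x : K.xCode f) => (x : Bits n) ⬝ᵥ v
  have hsyndrome (v v' : Bits n) :
      syndrome v = syndrome v' ↔ v + v' ∈ annihilator (K.xCode f) := by
    simp [syndrome, Set.rangeFactorization, Subtype.ext_iff, funext_iff, mem_annihilator,
      add_eq_zero_iff_eq]
  choose g hg hmem using fun u =>
    exists_rightInverse_mem (φ := syndrome) Set.rangeFactorization_surjective {v | N.p u v ≠ 0}
  exact ⟨⟨fun u v => g u (syndrome v), fun u v => (hsyndrome _ _).1 (hg u _),
    fun u v v' h => congrArg (g u) ((hsyndrome _ _).2 h)⟩, hmem⟩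

variable (D : PhaseEstimator K f)

/-- The Kraus operator of the decoder for the bit flip syndrome `j.1` and the phase syndrome of
`j.2`: undo the estimated error and the encoding. -/
def decoderOp (j : Bits (n - k) × Bits n) : Matrix (Bits m) (Bits n) ℂ :=
  (K.encoder f)ᴴ * (pauliX (K.uHat j.1) * pauliZ (D.est (K.uHat j.1) j.2))ᴴ

lemma conjTranspose_decoderOp_mul_self_apply (hf : IsFullRankAffine f)
    (j : Bits (n - k) × Bits n) (x x' : Bits n) : ((D.decoderOp j)ᴴ * D.decoderOp j) x x' =
      if K.H *ᵥ x = j.1 ∧ x + x' ∈ K.xCode f then sign (x + x') j.2 * (2 ^ m / 2 ^ k) else 0 := by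
  have hprod : (D.decoderOp j)ᴴ * D.decoderOp j =
      (pauliX (K.uHat j.1) * pauliZ (D.est (K.uHat j.1) j.2)) *
        (K.encoder f * (K.encoder f)ᴴ) *
        (pauliX (K.uHat j.1) * pauliZ (D.est (K.uHat j.1) j.2))ᴴ := by
    simp only [decoderOp, Matrix.conjTranspose_mul, Matrix.conjTranspose_conjTranspose,
      Matrix.mul_assoc]
  have hshift : x + K.uHat j.1 + (x' + K.uHat j.1) = x + x' := by
    rw [add_comm x', ZModModule.add_add_add_cancel]
  rw [hprod, pauli_mul_mul_conjTranspose_apply, K.encoder_mul_conjTranspose_apply hf, hshift,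
    Matrix.mulVec_add, K.syndrome_uHat, mul_ite, mul_zero]
  simp only [add_eq_zero_iff_eq]
  refine if_ctx_congr Iff.rfl (fun h => ?_) fun _ => rfl
  have hsign := sign_eq_one_of_mem_annihilator (D.est_add_mem (K.uHat j.1) j.2) h.2
  rw [← add_add_cancel_self (D.est _ _) j.2, sign_add_right, hsign, one_mul]

-- Each phase syndrome is represented by `#(annihilator (K.xCode f))` phase errors, whence the
-- weight of the Kraus operators.
lemma sum_conjTranspose_decoderOp_mul_self (hf : IsFullRankAffine f) :
    ∑ j, ((((annihilator (K.xCode f)).card : ℝ)⁻¹ : ℝ) : ℂ) • ((D.decoderOp j)ᴴ * D.decoderOp j)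
      = 1 := by
  have hcount : (((annihilator (K.xCode f)).card : ℂ))⁻¹ * (2 ^ n * (2 ^ m / 2 ^ k)) = 1 := by
    rw [← card_annihilator_mul_card (K.add_mem_xCode hf) K.zero_mem_xCode, K.card_xCode,
      hf.cast_card_hashKernel]
    have h0 : ((annihilator (K.xCode f)).card : ℂ) ≠ 0 :=
      Nat.cast_ne_zero.2 card_annihilator_ne_zero
    field_simp
  rw [← Finset.smul_sum]
  ext x x'
  have hsum : ∑ j, ((D.decoderOp j)ᴴ * D.decoderOp j) x x' =
      if x + x' ∈ K.xCode f then (∑ v, sign v (x + x')) * (2 ^ m / 2 ^ k) else 0 := by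
    simp only [D.conjTranspose_decoderOp_mul_self_apply hf, Fintype.sum_prod_type_right, ite_and,
      Finset.sum_ite_eq, Finset.mem_univ, if_true, Finset.sum_ite_irrel, Finset.sum_const_zero,
      Finset.sum_mul, sign_comm (x + x')]
  rw [Matrix.smul_apply, Matrix.sum_apply, hsum, sum_univ_sign, Matrix.one_apply, smul_eq_mul,
    Complex.ofReal_inv, Complex.ofReal_natCast]
  by_cases hx : x = x'
  · rw [hx, ZModModule.add_self, if_pos K.zero_mem_xCode, if_pos rfl, if_pos rfl, hcount]
  · rw [if_neg (mt add_eq_zero_iff_eq.1 hx), zero_mul, ite_self, mul_zero, if_neg hx]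

/-- The P-CSS code that is decoded by measuring both syndromes and undoing the error estimated from
them by `K.uHat` and `D`. -/
def pcssCode (hf : IsFullRankAffine f) : EntGenCode n m where
  encoder := K.encoder f
  isometry := K.encoder_isometry hf
  decoder := krausMap (fun _ => ((annihilator (K.xCode f)).card : ℝ)⁻¹) D.decoderOp
  isQuantumOperation := isQuantumOperation_krausMap (fun _ => by positivity)
    (D.sum_conjTranspose_decoderOp_mul_self hf)

lemma isPCSS_pcssCode (hf : IsFullRankAffine f) : (D.pcssCode hf).IsPCSS K f where
  encoder_eq _ _ := rfl
  stabilized ψ := by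
    simp only [← K.mem_xCode_iff_mem_cosetSet]
    exact K.mem_range_encoder_iff hf

end PhaseEstimator

end Decoder

namespace PhaseEstimator

variable {n k m : ℕ} {K : ClassicalCode n k} {f : Bits k → Bits m} (D : PhaseEstimator K f)
  (N : PauliChannel n)

/-- The errors `X^u Z^v` whose estimate agrees with them up to an operator that acts trivially on
the code space. -/
def correctedErrors : Finset (Bits n × Bits n) :=
  {i | K.uHat (K.H *ᵥ i.1) = i.1 ∧ K.Gᵀ *ᵥ (D.est i.1 i.2 + i.2) = 0}

/-- The pairs of a Kraus operator of the decoder and an error of the channel whose product restores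
the encoded state: the syndromes of the former are those of the latter, which is corrected. -/
def correctedTerms : Finset ((Bits (n - k) × Bits n) × (Bits n × Bits n)) :=
  {i | i.2 ∈ D.correctedErrors ∧ i.1.1 = K.H *ᵥ i.2.1 ∧
    i.1.2 + i.2.2 ∈ annihilator (K.xCode f)}

lemma decoderOp_mul_pauli_mul_encoder (hf : IsFullRankAffine f)
    {i : (Bits (n - k) × Bits n) × (Bits n × Bits n)} (hi : i ∈ D.correctedTerms) :
    D.decoderOp i.1 * (pauliX i.2.1 * pauliZ i.2.2 * K.encoder f) = 1 := by
  obtain ⟨⟨e, v'⟩, u, v⟩ := i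
  simp only [correctedTerms, correctedErrors, Finset.mem_filter, Finset.mem_univ, true_and] at hi
  obtain ⟨⟨hu, hv⟩, rfl, hv'⟩ := hi
  rw [decoderOp, hu, D.est_congr _ _ _ hv', Matrix.mul_assoc, ← Matrix.mul_assoc _ _ (K.encoder f),
    conjTranspose_pauli_mul_pauli, K.pauliZ_mul_encoder hv, K.encoder_isometry hf]

lemma sum_correctedTerms :
    ∑ i ∈ D.correctedTerms, ((annihilator (K.xCode f)).card : ℝ)⁻¹ * N.p i.2.1 i.2.2 =
      ∑ i ∈ D.correctedErrors, N.p i.1 i.2 := by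
  set w := ((annihilator (K.xCode f)).card : ℝ)⁻¹ with hw
  have hphase (v : Bits n) : ∑ v', (if v' + v ∈ annihilator (K.xCode f) then w else 0) = 1 := by
    have h0 : ((annihilator (K.xCode f)).card : ℝ) ≠ 0 :=
      Nat.cast_ne_zero.2 card_annihilator_ne_zero
    refine (Fintype.sum_equiv (Equiv.addRight v) _
      (fun v' => if v' ∈ annihilator (K.xCode f) then w else 0) fun _ => rfl).trans ?_
    simp [hw, h0]
  have hterms (i : Bits n × Bits n) :
      ∑ j, (if (j, i) ∈ D.correctedTerms then w * N.p i.1 i.2 else 0) =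
        if i ∈ D.correctedErrors then N.p i.1 i.2 else 0 := by
    simp only [correctedTerms, Finset.mem_filter, Finset.mem_univ, true_and, ite_and,
      Finset.sum_ite_irrel, Finset.sum_const_zero, Fintype.sum_prod_type_right,
      Finset.sum_ite_eq', if_true]
    simp only [← ite_zero_mul, ← Finset.sum_mul, hphase, one_mul]
  rw [← Fintype.sum_ite_mem D.correctedTerms, ← Fintype.sum_ite_mem D.correctedErrors,
    Fintype.sum_prod_type_right]
  exact Finset.sum_congr rfl fun i _ => hterms i

lemma error_pcssCode_le_one_sub (hf : IsFullRankAffine f) :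
    (D.pcssCode hf).error N ≤ 2 * (1 - ∑ i ∈ D.correctedErrors, N.p i.1 i.2) := by
  have hcomp : (D.pcssCode hf).decoder ∘ₗ N.toLinearMap ∘ₗ
      sandwich (D.pcssCode hf).encoder (D.pcssCode hf).encoderᴴ =
      krausMap (fun i : (Bits (n - k) × Bits n) × (Bits n × Bits n) =>
        ((annihilator (K.xCode f)).card : ℝ)⁻¹ * N.p i.2.1 i.2.2)
        fun i => D.decoderOp i.1 * (pauliX i.2.1 * pauliZ i.2.2 * K.encoder f) := by
    rw [N.toLinearMap_eq_krausMap, krausMap_comp_sandwich]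
    exact krausMap_comp _ _ _ _
  have htr (ρ : Matrix (Bits m) (Bits m) ℂ) : (((D.pcssCode hf).decoder ∘ₗ N.toLinearMap ∘ₗ
      sandwich (D.pcssCode hf).encoder (D.pcssCode hf).encoderᴴ) ρ).trace = ρ.trace := by
    rw [LinearMap.comp_apply, LinearMap.comp_apply,
      (D.pcssCode hf).isQuantumOperation.tracePreserving, N.trace_toLinearMap,
      trace_sandwich_of_isometry (D.pcssCode hf).isometry]
  rw [EntGenCode.error, ← D.sum_correctedTerms]
  rw [hcomp] at htr ⊢
  exact traceNorm_idTensor_krausMap_sub_le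
    (fun i => mul_nonneg (by positivity) (N.nonneg _ _)) htr
    (fun i => D.decoderOp_mul_pauli_mul_encoder hf) (posSemidef_ketbra _) (trace_ketbra_ebits m)

/-- The probability that the phase error is estimated incorrectly from its syndrome and the true bit
flip error. -/
def phaseErrorProb : ℝ := ∑ u, ∑ v with K.Gᵀ *ᵥ (D.est u v + v) ≠ 0, N.p u v

end PhaseEstimator

namespace PauliChannel

variable {n : ℕ} (N : PauliChannel n)

lemma bitFlip_nonneg (u : Bits n) : 0 ≤ N.bitFlip u :=
  Finset.sum_nonneg fun v _ => N.nonneg u v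

lemma sum_bitFlip : ∑ u, N.bitFlip u = 1 := N.sum_eq_one

end PauliChannel

namespace ClassicalCode

variable {n k : ℕ} (K : ClassicalCode n k) (N : PauliChannel n)

lemma syndromeProb_mul_one_sub_condProb (e : Bits (n - k)) :
    K.syndromeProb N e * (1 - K.condProb N (K.uHat e) e) =
      K.syndromeProb N e - N.bitFlip (K.uHat e) := by
  have hle : N.bitFlip (K.uHat e) ≤ K.syndromeProb N e :=
    Finset.single_le_sum (fun u _ => N.bitFlip_nonneg u) (by simp [K.syndrome_uHat])
  rw [condProb, if_pos (K.syndrome_uHat e), one_mul]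
  rcases eq_or_ne (K.syndromeProb N e) 0 with h0 | h0
  · rw [h0] at hle
    rw [h0, le_antisymm hle (N.bitFlip_nonneg _), zero_mul, sub_zero]
  · rw [mul_one_sub, mul_div_cancel₀ _ h0]

lemma avgError_eq_sum_bitFlip : K.avgError N = ∑ u with K.uHat (K.H *ᵥ u) ≠ u, N.bitFlip u := by
  rw [avgError, Finset.sum_filter, ← Finset.sum_fiberwise _ fun u => K.H *ᵥ u]
  refine Finset.sum_congr rfl fun e _ => ?_
  have hsingle : N.bitFlip (K.uHat e) =
      ∑ u with K.H *ᵥ u = e, if K.uHat e = u then N.bitFlip u else 0 := by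
    rw [Finset.sum_ite_eq, if_pos (by simp [K.syndrome_uHat])]
  rw [syndromeProb_mul_one_sub_condProb, hsingle, syndromeProb, ← Finset.sum_sub_distrib]
  refine Finset.sum_congr rfl fun u hu => ?_
  rw [(Finset.mem_filter.1 hu).2]
  split_ifs <;> simp_all

lemma avgError_nonneg : 0 ≤ K.avgError N :=
  K.avgError_eq_sum_bitFlip N ▸ Finset.sum_nonneg fun u _ => N.bitFlip_nonneg u

lemma avgError_le_one : K.avgError N ≤ 1 := by
  rw [avgError_eq_sum_bitFlip, ← N.sum_bitFlip]
  exact Finset.sum_le_univ_sum_of_nonneg N.bitFlip_nonneg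

end ClassicalCode

namespace PhaseEstimator

variable {n k m : ℕ} {K : ClassicalCode n k} {f : Bits k → Bits m} (D : PhaseEstimator K f)
  (N : PauliChannel n)

lemma one_sub_sum_correctedErrors_le :
    1 - ∑ i ∈ D.correctedErrors, N.p i.1 i.2 ≤ K.avgError N + D.phaseErrorProb N := by
  have hcompl : 1 - ∑ i ∈ D.correctedErrors, N.p i.1 i.2 =
      ∑ i ∈ D.correctedErrorsᶜ, N.p i.1 i.2 := by
    rw [← N.sum_eq_one, ← Fintype.sum_prod_type', ← Finset.sum_add_sum_compl D.correctedErrors,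
      add_sub_cancel_left]
  rw [hcompl, K.avgError_eq_sum_bitFlip, phaseErrorProb, Finset.sum_filter,
    ← Finset.sum_add_distrib, ← Fintype.sum_ite_mem, Fintype.sum_prod_type]
  refine Finset.sum_le_sum fun u _ => ?_
  rw [Finset.sum_filter]
  by_cases hu : K.uHat (K.H *ᵥ u) = u
  · simp [correctedErrors, hu]
  · rw [if_pos hu, PauliChannel.bitFlip, ← Finset.sum_add_distrib]
    refine Finset.sum_le_sum fun v _ => ?_
    have hp := N.nonneg u v
    split_ifs <;> linarith

lemma error_pcssCode_le (hf : IsFullRankAffine f) :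
    (D.pcssCode hf).error N ≤ 2 * (K.avgError N + D.phaseErrorProb N) :=
  (D.error_pcssCode_le_one_sub N hf).trans <|
    mul_le_mul_of_nonneg_left (D.one_sub_sum_correctedErrors_le N) zero_le_two

end PhaseEstimator

namespace PauliChannel

variable {n : ℕ} (N : PauliChannel n)

lemma omega_apply (x x' b b' : Bits n) (e e' : Bits n × Bits n) :
    N.omega (x, b, e) (x', b', e') =
      if x = x' then 1 / 2 ^ n * (N.phi x (b, e) * star (N.phi x (b', e'))) else 0 := by
  simp only [omega, ketbra, Matrix.smul_apply, Matrix.sum_apply, Matrix.kronecker,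
    Matrix.kroneckerMap_apply, Matrix.single_apply, Matrix.vecMulVec_apply, Pi.star_apply,
    ite_and, ite_zero_mul, one_mul, Finset.sum_ite_eq', Finset.mem_univ, if_true, smul_eq_mul,
    mul_ite, mul_zero]

lemma omegaXE_apply (x x' u v u' v' : Bits n) :
    N.omegaXE (x, u, v) (x', u', v') = if x = x' ∧ u = u' then
      1 / 2 ^ n * ((√(N.p u v) * √(N.p u' v') : ℝ) * sign x (v + v')) else 0 := by
  simp only [omegaXE, traceMid, Matrix.of_apply, omega_apply, ite_and]
  split_ifs with hx hu
  · subst hx hu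
    simp only [phi, apply_ite (star : ℂ → ℂ), star_zero, mul_ite, mul_zero, Finset.sum_ite_eq',
      Finset.mem_univ, if_true, star_mul', RCLike.star_def, Complex.conj_ofReal, conj_sign,
      sign_add_right, Complex.ofReal_mul]
    ring
  · refine Finset.sum_eq_zero fun y _ => ?_
    have hphi : N.phi x (y, u, v) * star (N.phi x (y, u', v')) = 0 := by
      by_cases hy : y = x + u <;> simp [phi, hy, hu]
    rw [hphi, mul_zero]
  · exact Finset.sum_const_zero

lemma omegaE_eq_diagonal :
    N.omegaE = Matrix.diagonal fun e : Bits n × Bits n => (N.p e.1 e.2 : ℂ) := by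
  ext ⟨u, v⟩ ⟨u', v'⟩
  have hpow : (2 : ℂ) ^ n ≠ 0 := pow_ne_zero n two_ne_zero
  simp only [omegaE, traceFst, Matrix.of_apply, omegaXE_apply, true_and, Matrix.diagonal_apply,
    Prod.mk.injEq, ite_and, Finset.sum_ite_irrel, ← Finset.mul_sum, sum_univ_sign,
    add_eq_zero_iff_eq, Finset.sum_const_zero]
  split_ifs with hu hv
  · subst hu hv
    rw [Real.mul_self_sqrt (N.nonneg u v)]
    field_simp
  all_goals simp

/-- The number of phase errors that are possible when the bit flip error is `u`. -/
def phaseCount (u : Bits n) : ℕ := (Finset.univ.filter fun v => N.p u v ≠ 0).card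

lemma rank_omegaE : N.omegaE.rank = ∑ u, N.phaseCount u := by
  rw [omegaE_eq_diagonal, Matrix.rank_diagonal, Fintype.card_subtype]
  simp only [Finset.card_filter, Fintype.sum_prod_type, phaseCount, ne_eq,
    Complex.ofReal_eq_zero]

lemma omegaXE_apply_mul_apply (x x' u v u' v' : Bits n) :
    N.omegaXE (x, u, v) (x', u', v') * N.omegaXE (x', u', v') (x, u, v) =
      if x = x' ∧ u = u' then
        ((1 / 2 ^ n * (1 / 2 ^ n) * (N.p u v * N.p u v') : ℝ) : ℂ) else 0 := by
  simp only [omegaXE_apply, eq_comm (a := x'), eq_comm (a := u'), ite_zero_mul_ite_zero, and_self]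
  split_ifs with h
  · obtain ⟨rfl, rfl⟩ := h
    have hv : (√(N.p u v) : ℂ) ^ 2 = N.p u v := by
      exact_mod_cast Real.sq_sqrt (N.nonneg u v)
    have hv' : (√(N.p u v') : ℂ) ^ 2 = N.p u v' := by
      exact_mod_cast Real.sq_sqrt (N.nonneg u v')
    rw [add_comm v']
    push_cast
    rw [← hv, ← hv']
    linear_combination (1 / 2 ^ n * (1 / 2 ^ n) * (√(N.p u v) ^ 2 *
      √(N.p u v') ^ 2) : ℂ) * sign_mul_self x (v + v')
  · rfl

lemma trace_omegaXE_sq : (N.omegaXE ^ 2).trace = ((1 / 2 ^ n * ∑ u, N.bitFlip u ^ 2 : ℝ) : ℂ) := by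
  have hu (u : Bits n) : ∑ v, ∑ v', N.p u v * N.p u v' = N.bitFlip u ^ 2 := by
    rw [sq, bitFlip, Finset.sum_mul_sum]
  simp only [sq N.omegaXE, Matrix.trace, Matrix.diag, Matrix.mul_apply, Fintype.sum_prod_type,
    omegaXE_apply_mul_apply, ite_and, Finset.sum_ite_irrel, Finset.sum_const_zero,
    Finset.sum_ite_eq, Finset.mem_univ, if_true]
  simp only [← Complex.ofReal_sum, ← Finset.mul_sum _ _ (1 / 2 ^ n * (1 / 2 ^ n) : ℝ), hu,
    Finset.sum_const, Finset.card_univ,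
    Fintype.card_pi, ZMod.card, Finset.prod_const, Fintype.card_fin, nsmul_eq_mul]
  push_cast
  field_simp

lemma exists_pos : ∃ u v, 0 < N.p u v := by
  by_contra! h
  have : ∑ u, ∑ v, N.p u v ≤ 0 :=
    Finset.sum_nonpos fun u _ => Finset.sum_nonpos fun v _ => h u v
  linarith [N.sum_eq_one]

lemma sum_bitFlip_sq_pos : 0 < ∑ u, N.bitFlip u ^ 2 := by
  obtain ⟨u, v, h⟩ := N.exists_pos
  have hu : 0 < N.bitFlip u :=
    h.trans_le (Finset.single_le_sum (fun v _ => N.nonneg u v) (Finset.mem_univ v))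
  exact Finset.sum_pos' (fun u _ => sq_nonneg _) ⟨u, Finset.mem_univ u, pow_pos hu 2⟩

lemma sum_phaseCount_pos : 0 < ∑ u, N.phaseCount u := by
  obtain ⟨u, v, h⟩ := N.exists_pos
  exact Finset.sum_pos' (fun u _ => Nat.zero_le _)
    ⟨u, Finset.mem_univ u, Finset.card_pos.2 ⟨v, by simp [h.ne']⟩⟩

lemma renyiTwo_omegaXE :
    renyiTwo N.omegaXE = n - Real.logb 2 (∑ u, N.bitFlip u ^ 2) := by
  rw [renyiTwo, trace_omegaXE_sq, Complex.ofReal_re,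
    Real.logb_mul (by positivity) N.sum_bitFlip_sq_pos.ne', one_div (2 ^ n), Real.logb_inv,
    Real.logb_pow, Real.logb_self_eq_one one_lt_two]
  ring

lemma renyiZero_omegaE : renyiZero N.omegaE = Real.logb 2 (∑ u, N.phaseCount u : ℕ) := by
  rw [renyiZero, rank_omegaE]

lemma privacyError_eq_sqrt (k m : ℕ) : privacyError N k m =
    √((∑ u, N.bitFlip u ^ 2) * ∑ u, 2 ^ m / 2 ^ k * (N.phaseCount u : ℝ)) := by
  have hB := N.sum_bitFlip_sq_pos
  have hS : (0 : ℝ) < (∑ u, N.phaseCount u : ℕ) := Nat.cast_pos.2 N.sum_phaseCount_pos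
  rw [← Finset.mul_sum, ← Nat.cast_sum, Real.sqrt_eq_rpow, privacyError, renyiTwo_omegaXE,
    renyiZero_omegaE]
  generalize ∑ u, N.bitFlip u ^ 2 = B at hB
  generalize ((∑ u, N.phaseCount u : ℕ) : ℝ) = S at hS
  have hlog : Real.logb 2 (B * (2 ^ m / 2 ^ k * S)) =
      Real.logb 2 B + (m - k + Real.logb 2 S) := by
    rw [Real.logb_mul hB.ne' (by positivity), Real.logb_mul (by positivity) hS.ne',
      Real.logb_div (by positivity) (by positivity), Real.logb_pow, Real.logb_pow,
      Real.logb_self_eq_one one_lt_two, mul_one, mul_one]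
  rw [← Real.rpow_logb two_pos one_lt_two.ne' (show 0 < B * (2 ^ m / 2 ^ k * S) by positivity),
    ← Real.rpow_mul two_pos.le, hlog]
  congr 1
  ring

end PauliChannel

namespace PhaseEstimator

variable {n k m : ℕ} {K : ClassicalCode n k} (D : ∀ f : Bits k → Bits m, PhaseEstimator K f)
  (N : PauliChannel n) {P : PMF (Bits k → Bits m)}

/-- The probability over the random function that the error `X^u Z^v` has its phase part estimated
incorrectly. -/
def missProb (P : PMF (Bits k → Bits m)) (u v : Bits n) : ℝ :=
  ∑ f with K.Gᵀ *ᵥ ((D f).est u v + v) ≠ 0, (P f).toReal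

lemma missProb_nonneg (u v : Bits n) : 0 ≤ missProb D P u v :=
  Finset.sum_nonneg fun _ _ => ENNReal.toReal_nonneg

lemma missProb_le_one (u v : Bits n) : missProb D P u v ≤ 1 :=
  (Finset.sum_le_univ_sum_of_nonneg fun _ => ENNReal.toReal_nonneg).trans_eq
    (sum_toReal_eq_one P)

lemma sum_mul_phaseErrorProb_eq_sum_mul_missProb :
    ∑ f, (P f).toReal * (D f).phaseErrorProb N = ∑ u, ∑ v, N.p u v * missProb D P u v := by
  simp only [phaseErrorProb, missProb, Finset.sum_filter, Finset.mul_sum, mul_ite, mul_zero]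
  rw [Finset.sum_comm]
  refine Finset.sum_congr rfl fun u _ => ?_
  rw [Finset.sum_comm]
  simp only [mul_comm]

lemma sum_mul_phaseErrorProb_nonneg : 0 ≤ ∑ f, (P f).toReal * (D f).phaseErrorProb N := by
  rw [sum_mul_phaseErrorProb_eq_sum_mul_missProb]
  exact Finset.sum_nonneg fun u _ => Finset.sum_nonneg fun v _ =>
    mul_nonneg (N.nonneg u v) (missProb_nonneg D u v)

lemma sum_mul_phaseErrorProb_le_one : ∑ f, (P f).toReal * (D f).phaseErrorProb N ≤ 1 := by
  rw [sum_mul_phaseErrorProb_eq_sum_mul_missProb, ← N.sum_eq_one]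
  exact Finset.sum_le_sum fun u _ => Finset.sum_le_sum fun v _ =>
    mul_le_of_le_one_right (N.nonneg u v) (missProb_le_one D u v)

variable {D N}

/-- Union bound over the possible phase errors that a plausible estimate may confuse with `v`: the
random stabilizers have to miss the difference. -/
lemma missProb_le_sum_annihilatorProb (hD : ∀ f, (D f).IsPlausible N) {u v : Bits n}
    (huv : N.p u v ≠ 0) : missProb D P u v ≤
      ∑ v' with N.p u v' ≠ 0 ∧ K.Gᵀ *ᵥ (v' + v) ≠ 0, annihilatorProb P (K.Gᵀ *ᵥ (v' + v)) := by
  simp only [missProb, annihilatorProb, Finset.sum_filter _ fun _ : Bits k → Bits m => _]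
  rw [Finset.sum_comm]
  refine Finset.sum_le_sum fun f _ => ?_
  have hnonneg (v' : Bits n) : 0 ≤
      if K.Gᵀ *ᵥ (v' + v) ∈ annihilator (hashKernel f) then (P f).toReal else 0 :=
    ite_nonneg ENNReal.toReal_nonneg le_rfl
  split_ifs with hmiss
  · refine le_trans (le_of_eq ?_) (Finset.single_le_sum (fun v' _ => hnonneg v')
      (Finset.mem_filter.2 ⟨Finset.mem_univ ((D f).est u v), hD f u v huv, hmiss⟩))
    rw [if_pos (K.mem_annihilator_xCode.1 ((D f).est_add_mem u v))]
  · exact Finset.sum_nonneg fun v' _ => hnonneg v'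

lemma missProb_le (hP : IsTwoUniversal P) (hA : ∀ f ∈ P.support, IsFullRankAffine f)
    (hD : ∀ f, (D f).IsPlausible N) {u v : Bits n} (huv : N.p u v ≠ 0) :
    missProb D P u v ≤ 2 * (2 ^ m / 2 ^ k * (N.phaseCount u : ℝ)) := by
  set W : Finset (Bits n) := {v' | N.p u v' ≠ 0 ∧ K.Gᵀ *ᵥ (v' + v) ≠ 0}
  have hcard : W.card ≤ N.phaseCount u :=
    Finset.card_le_card <| Finset.monotone_filter_right _ fun _ _ h => h.1
  calc missProb D P u v
      ≤ ∑ v' ∈ W, annihilatorProb P (K.Gᵀ *ᵥ (v' + v)) := missProb_le_sum_annihilatorProb hD huv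
    _ ≤ W.card • (2 * (2 ^ m / 2 ^ k) : ℝ) := Finset.sum_le_card_nsmul _ _ _ fun v' hv' =>
        hP.annihilatorProb_le hA (Finset.mem_filter.1 hv').2.2
    _ ≤ N.phaseCount u * (2 * (2 ^ m / 2 ^ k)) := by
        rw [nsmul_eq_mul]
        gcongr
    _ = 2 * (2 ^ m / 2 ^ k * (N.phaseCount u : ℝ)) := by ring

lemma sum_mul_phaseErrorProb_le (hP : IsTwoUniversal P)
    (hA : ∀ f ∈ P.support, IsFullRankAffine f) (hD : ∀ f, (D f).IsPlausible N) :
    ∑ f, (P f).toReal * (D f).phaseErrorProb N ≤ √2 * privacyError N k m := by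
  -- A probability is at most its square root, which is what makes Cauchy–Schwarz produce `Σ p_u²`.
  have hsqrt (u v : Bits n) : N.p u v * missProb D P u v ≤
      N.p u v * √(2 * (2 ^ m / 2 ^ k * (N.phaseCount u : ℝ))) := by
    rcases eq_or_ne (N.p u v) 0 with hp | hp
    · simp [hp]
    · refine mul_le_mul_of_nonneg_left (Real.le_sqrt_of_sq_le ?_) (N.nonneg u v)
      exact (sq_le (missProb_nonneg D u v) (missProb_le_one D u v)).trans
        (missProb_le hP hA hD hp)
  calc ∑ f, (P f).toReal * (D f).phaseErrorProb N
      ≤ ∑ u, ∑ v, N.p u v * √(2 * (2 ^ m / 2 ^ k * (N.phaseCount u : ℝ))) := by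
        rw [sum_mul_phaseErrorProb_eq_sum_mul_missProb]
        exact Finset.sum_le_sum fun u _ => Finset.sum_le_sum fun v _ => hsqrt u v
    _ = √2 * ∑ u, N.bitFlip u * √(2 ^ m / 2 ^ k * (N.phaseCount u : ℝ)) := by
        simp only [← Finset.sum_mul, Real.sqrt_mul zero_le_two, mul_left_comm _ (√2),
          ← Finset.mul_sum, PauliChannel.bitFlip]
    _ ≤ √2 * (√(∑ u, N.bitFlip u ^ 2) *
          √(∑ u, √(2 ^ m / 2 ^ k * (N.phaseCount u : ℝ)) ^ 2)) := by
        gcongr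
        exact Real.sum_mul_le_sqrt_mul_sqrt _ _ _
    _ = √2 * privacyError N k m := by
        rw [N.privacyError_eq_sqrt, Real.sqrt_mul N.sum_bitFlip_sq_pos.le]
        simp only [Real.sq_sqrt (show 0 ≤ 2 ^ m / 2 ^ k * (N.phaseCount _ : ℝ) by positivity)]

end PhaseEstimator

lemma privacyError_nonneg {n : ℕ} (N : PauliChannel n) (k m : ℕ) : 0 ≤ privacyError N k m :=
  Real.rpow_nonneg zero_le_two _

lemma two_mul_add_le_of_le_sqrt_two_mul {a b t : ℝ} (ha0 : 0 ≤ a) (ha1 : a ≤ 1) (hb : 0 ≤ b)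
    (ht0 : 0 ≤ t) (ht1 : t ≤ 1) (htb : t ≤ √2 * b) :
    2 * (a + t) ≤ 2 * √(2 * b + 4 * √(2 * a)) + 2 * √(2 * a) := by
  have ha : a ≤ √(2 * a) := Real.le_sqrt_of_sq_le (by nlinarith)
  have ht : t ≤ √(2 * b + 4 * √(2 * a)) := by
    refine Real.le_sqrt_of_sq_le ?_
    calc t ^ 2 ≤ t := sq_le ht0 ht1
      _ ≤ √2 * b := htb
      _ ≤ 2 * b := by
          gcongr
          exact Real.sqrt_le_iff.2 (by norm_num)
      _ ≤ 2 * b + 4 * √(2 * a) := le_add_of_nonneg_right (by positivity)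
  linarith

end PCSS

end

theorem theorem1 {n k m : ℕ} (N : PCSS.PauliChannel n) (K : PCSS.ClassicalCode n k)
    (P : PMF (PCSS.Bits k → PCSS.Bits m))
    (hAffine : ∀ f ∈ P.support, PCSS.IsFullRankAffine f)
    (hUniversal : PCSS.IsTwoUniversal P) :
    ∃ Q : (PCSS.Bits k → PCSS.Bits m) → PCSS.EntGenCode n m,
      (∀ f ∈ P.support, (Q f).IsPCSS K f) ∧
      PCSS.IsGoodOnAverage P Q N
        (2 * Real.sqrt (2 * PCSS.privacyError N k m + 4 * Real.sqrt (2 * K.avgError N))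
          + 2 * Real.sqrt (2 * K.avgError N)) := by
  classical
  choose D hD using fun f : PCSS.Bits k → PCSS.Bits m =>
    PCSS.PhaseEstimator.exists_isPlausible K f N
  obtain ⟨f₀, hf₀⟩ := P.support_nonempty
  let Q f := if hf : f ∈ P.support then (D f).pcssCode (hAffine f hf)
    else (D f₀).pcssCode (hAffine f₀ hf₀)
  have hQ f (hf : f ∈ P.support) : Q f = (D f).pcssCode (hAffine f hf) := dif_pos hf
  refine ⟨Q, fun f hf => hQ f hf ▸ (D f).isPCSS_pcssCode (hAffine f hf), ?_⟩
  calc ∑ f, (P f).toReal * (Q f).error N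
      ≤ ∑ f, (P f).toReal * (2 * (K.avgError N + (D f).phaseErrorProb N)) :=
        PCSS.sum_toReal_mul_mono P fun f hf => hQ f hf ▸ (D f).error_pcssCode_le N (hAffine f hf)
    _ = 2 * (K.avgError N + ∑ f, (P f).toReal * (D f).phaseErrorProb N) := by
        simp only [mul_left_comm _ (2 : ℝ), mul_add, Finset.sum_add_distrib, ← Finset.mul_sum,
          ← Finset.sum_mul, PCSS.sum_toReal_eq_one, one_mul]
    _ ≤ _ := PCSS.two_mul_add_le_of_le_sqrt_two_mul (K.avgError_nonneg N) (K.avgError_le_one N)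
        (PCSS.privacyError_nonneg N k m)
        (PCSS.PhaseEstimator.sum_mul_phaseErrorProb_nonneg D N)
        (PCSS.PhaseEstimator.sum_mul_phaseErrorProb_le_one D N)
        (PCSS.PhaseEstimator.sum_mul_phaseErrorProb_le hUniversal hAffine hD)
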